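/- Let $k,m\ge 0$ be integers, let $\eta>0$, and let $d$ be a real number with $0\le d<k$. Let $\Omega\subseteq\mathbb{R}^k$ be a nonempty bounded open set, and let $F$ be a locally Lipschitz map from $\Omega\times\mathbb{R}^{m}$ to the space of linear maps $\mathbb{R}^k\to\mathbb{R}^{m}$ (equivalently, to the $m\times k$ real matrices). Then there are a nonempty compact set $\mathfrak{C}\subseteq\Omega$ and a function $u:\mathbb{R}^k\to\mathbb{R}^{m}$ such that (i) $\mathrm{supp}(u)\subseteq\Omega$ (where $\mathrm{supp}(u)$ is the closure in $\mathbb{R}^k$ of $\{u\ne 0\}$), $|u(x)|\le\eta$ for all $x$, and $u$ is differentiable at every $x\in\mathfrak{C}$ with $Du(x)=F(x,u(x))$; (ii) the Hausdorff dimension of $\mathfrak{C}$ is exactly $d$; (iii) $u$ is of class $C^{1,1}(\Omega)$, that is, $u$ is continuously differentiable on $\Omega$, $u$ and $Du$ are bounded on $\Omega$, and $Du$ is Lipschitz on $\Omega$. -/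

import Mathlib

open scoped NNReal ENNReal

/-- `u` is of class `C^{1,1}` on the open set `Ω`: it is continuously differentiable on `Ω`,
`u` and its differential are bounded on `Ω`, and the differential is (globally) Lipschitz
on `Ω`. -/
def IsC11On {E E' : Type*} [NormedAddCommGroup E] [NormedSpace ℝ E]
    [NormedAddCommGroup E'] [NormedSpace ℝ E'] (u : E → E') (Ω : Set E) : Prop :=
  ContDiffOn ℝ 1 u Ω ∧
    (∃ M : ℝ, ∀ x ∈ Ω, ‖u x‖ ≤ M ∧ ‖fderiv ℝ u x‖ ≤ M) ∧
    ∃ L : ℝ≥0, LipschitzOnWith L (fderiv ℝ u) Ω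

/-!
The set `C` is a small homothetic copy of a self-similar Cantor dust `S` in a cube, generated by the
`2 ^ k` maps `y ↦ v e + lam • y` with `v e` the vectors with coordinates `±1/2` and with
`lam ^ d = 2 ^ (-k)`, so that `lam < 1 / 2` because `d < k` (for `d = 0` a single point of a dust is
enough).

*The function.* Each cube of the construction is given a point `p = (c, a)` of the graph, over its
centre `c`, and the affine map `tangent F p` of slope `F p` through it. The point of a subcube lies
on the affine map of its parent, so passing from a cube of size `ℓ` to a subcube changes the slope
by `O(ℓ)`, since `F` is Lipschitz, and the affine map by `O(ℓ ^ 2)`. Interpolating between the two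
maps with a cut-off function at scale `ℓ` costs a second derivative of size `O(1)`. As
`lam < 1 / 2`, the transition zones of all cubes of all generations are disjoint (`approx_local`),
so these costs do not add up: the approximations converge geometrically in `C^1` and their second
derivatives are uniformly bounded (`exists_fderiv_fderiv_bound`). Hence the limit has a Lipschitz
derivative, and at a point `x` of the dust this derivative is the limit of the slopes `F p` with
`p → (x, u x)`, that is `F (x, u x)` (`exists_limit`). To make sense of this globally, `F` is first
replaced by a bounded Lipschitz map that agrees with it near the starting point, and the initial
affine map is cut off; a small initial scale makes the result small (`exists_solution`).

*The dimension.* The cylinder sets are efficient covers, which gives the upper bound. For the lower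
bound, the coordinatewise Cantor function, which reads an address as binary digits, maps the dust
onto the unit cube of dimension `k` and is Hölder continuous with exponent `d / k`
(`exists_holder`).
-/

/-! ### Nested interpolation of affine maps -/

namespace NestedInterpolation

open Filter Topology Set
open scoped ContDiff

variable {E E' ι : Type*} [NormedAddCommGroup E] [NormedSpace ℝ E]
  [NormedAddCommGroup E'] [NormedSpace ℝ E']

/-- The affine map through the point `p = (c, a)` with the slope `F p` prescribed there. -/
def tangent (F : E × E' → E →L[ℝ] E') (p : E × E') (x : E) : E' :=
  p.2 + F p (x - p.1)

/-- The point of the graph of `tangent F p` lying above `p.1 + ℓ • v e`. -/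
def child (F : E × E' → E →L[ℝ] E') (v : ι → E) (ℓ : ℝ) (p : E × E') (e : ι) : E × E' :=
  (p.1 + ℓ • v e, p.2 + F p (ℓ • v e))

/-- A linear map centred at `c`, cut off at scale `ℓ` by the profile `Ψ`. -/
noncomputable def cutLinear (Ψ : E → ℝ) (T : E →L[ℝ] E') (ℓ : ℝ) (c x : E) : E' :=
  Ψ (ℓ⁻¹ • (x - c)) • T (x - c)

/-- The `N`-th approximation, started at the point `p` and the scale `ℓ`: the affine map
`tangent F p`, replaced near each child of `p` by the approximation of order `N - 1` that is
started at that child and at the scale `lam * ℓ`. -/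
noncomputable def approx [Fintype ι] (F : E × E' → E →L[ℝ] E') (Ψ : E → ℝ) (v : ι → E) (lam : ℝ) :
    ℕ → ℝ → E × E' → E → E'
  | 0, _, p, x => tangent F p x
  | N + 1, ℓ, p, x => tangent F p x + ∑ e, Ψ (ℓ⁻¹ • (x - p.1) - v e) •
      (approx F Ψ v lam N (lam * ℓ) (child F v ℓ p e) x - tangent F p x)

/-- `Ψ` is a cut-off profile for the iterated function system `y ↦ v e + lam • y` and the set `K`:
it equals `1` near `lam • K`, and the translates of its support by the vectors `v e` are pairwise
disjoint subsets of `K`. -/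
structure IsProfile (K : Set E) (v : ι → E) (lam : ℝ) (Ψ : E → ℝ) : Prop where
  lam_pos : 0 < lam
  lam_lt : lam < 1
  smooth : ContDiff ℝ ∞ Ψ
  compact : HasCompactSupport Ψ
  one : ∀ y ∈ K, Ψ =ᶠ[𝓝 (lam • y)] fun _ => 1
  maps : ∀ e, ∀ y ∈ tsupport Ψ, y + v e ∈ K
  disj : ∀ e e' y, y - v e ∈ tsupport Ψ → y - v e' ∈ tsupport Ψ → e = e'

/-! ### Cut-off linear maps -/

section CutLinear

variable {Ψ : E → ℝ}

lemma contDiff_cutLinear (hΨ : ContDiff ℝ ∞ Ψ) (T : E →L[ℝ] E') (ℓ : ℝ) (c : E) :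
    ContDiff ℝ ∞ (cutLinear Ψ T ℓ c) := by
  unfold cutLinear
  fun_prop

/-- The bounds scale as for `ℓ • T (g (ℓ⁻¹ • (x - c)))` with `g y = Ψ y • y`, which is another
expression for the cut-off linear map. -/
lemma exists_cutLinear_bound (hΨ : ContDiff ℝ ∞ Ψ) (hc : HasCompactSupport Ψ) :
    ∃ G : ℝ≥0, ∀ (T : E →L[ℝ] E') (ℓ : ℝ), 0 < ℓ → ∀ c x : E,
      ‖cutLinear Ψ T ℓ c x‖ ≤ G * ‖T‖ * ℓ ∧ ‖fderiv ℝ (cutLinear Ψ T ℓ c) x‖ ≤ G * ‖T‖ ∧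
      ‖fderiv ℝ (fderiv ℝ (cutLinear Ψ T ℓ c)) x‖ ≤ G * ‖T‖ / ℓ := by
  set g : E → E := fun y => Ψ y • y with hg
  have hgs : ContDiff ℝ ∞ g := by fun_prop
  have hgc : HasCompactSupport g := hc.smul_right
  have hg1 : ContDiff ℝ ∞ (fderiv ℝ g) := hgs.fderiv_right (by simp)
  have hg2 : ContDiff ℝ ∞ (fderiv ℝ (fderiv ℝ g)) := hg1.fderiv_right (by simp)
  obtain ⟨C0, h0⟩ := hgs.continuous.bounded_above_of_compact_support hgc
  obtain ⟨C1, h1⟩ := hg1.continuous.bounded_above_of_compact_support (hgc.fderiv ℝ)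
  obtain ⟨C2, h2⟩ := hg2.continuous.bounded_above_of_compact_support ((hgc.fderiv ℝ).fderiv ℝ)
  lift C0 to ℝ≥0 using (norm_nonneg _).trans (h0 0)
  lift C1 to ℝ≥0 using (norm_nonneg _).trans (h1 0)
  lift C2 to ℝ≥0 using (norm_nonneg _).trans (h2 0)
  refine ⟨C0 + C1 + C2, fun T ℓ hℓ c x => ?_⟩
  have hfun : cutLinear Ψ T ℓ c = fun y => ℓ • T (g (ℓ⁻¹ • (y - c))) := by
    ext y
    simp [cutLinear, hg, smul_smul, mul_comm, hℓ.ne']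
  have haff : ∀ y, HasFDerivAt (fun y : E => ℓ⁻¹ • (y - c)) (ℓ⁻¹ • ContinuousLinearMap.id ℝ E) y :=
    fun y => ((hasFDerivAt_id y).sub_const c).const_smul _
  have hd1 : fderiv ℝ (cutLinear Ψ T ℓ c) = fun y => T ∘L fderiv ℝ g (ℓ⁻¹ • (y - c)) := by
    ext1 y
    rw [hfun]
    have hgd : HasFDerivAt g (fderiv ℝ g (ℓ⁻¹ • (y - c))) (ℓ⁻¹ • (y - c)) :=
      (hgs.differentiable (by simp) _).hasFDerivAt
    have := ((T.hasFDerivAt.comp y (hgd.comp y (haff y))).const_smul ℓ).fderiv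
    refine this.trans ?_
    ext z
    simp [smul_smul, hℓ.ne']
  refine ⟨?_, ?_, ?_⟩
  · rw [hfun]
    simp only [norm_smul, Real.norm_eq_abs, abs_of_pos hℓ]
    have : ‖T (g (ℓ⁻¹ • (x - c)))‖ ≤ ‖T‖ * (C0 + C1 + C2) :=
      (T.le_opNorm _).trans (by gcongr; linarith [h0 (ℓ⁻¹ • (x - c)), C1.coe_nonneg, C2.coe_nonneg])
    calc _ ≤ ℓ * (‖T‖ * (C0 + C1 + C2)) := by gcongr
      _ = _ := by push_cast; ring
  · rw [hd1]
    refine (ContinuousLinearMap.opNorm_comp_le _ _).trans ?_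
    rw [mul_comm]
    gcongr
    exact (h1 _).trans (by push_cast; linarith [C0.coe_nonneg, C2.coe_nonneg])
  · have hlip : LipschitzWith C2 (fderiv ℝ g) :=
      lipschitzWith_of_nnnorm_fderiv_le (hg1.differentiable (by simp)) fun y => h2 y
    have : LipschitzWith ((C0 + C1 + C2) * ‖T‖₊ / ℓ.toNNReal)
        (fderiv ℝ (cutLinear Ψ T ℓ c)) := by
      rw [hd1]
      refine LipschitzWith.of_dist_le_mul fun y z => ?_
      rw [dist_eq_norm, ← ContinuousLinearMap.comp_sub]
      refine (ContinuousLinearMap.opNorm_comp_le _ _).trans ?_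
      have h3 := hlip.dist_le_mul (ℓ⁻¹ • (y - c)) (ℓ⁻¹ • (z - c))
      rw [dist_eq_norm, dist_eq_norm, ← smul_sub, sub_sub_sub_cancel_right, norm_smul, norm_inv,
        Real.norm_eq_abs, abs_of_pos hℓ] at h3
      rw [dist_eq_norm]
      push_cast
      rw [Real.coe_toNNReal _ hℓ.le]
      calc _ ≤ ‖T‖ * ((C0 + C1 + C2) * (ℓ⁻¹ * ‖y - z‖)) := by
            gcongr
            refine h3.trans ?_
            gcongr
            linarith [C0.coe_nonneg, C1.coe_nonneg]
        _ = _ := by rw [div_eq_mul_inv]; ring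
    have := norm_fderiv_le_of_lipschitz ℝ (x₀ := x) this
    simpa [Real.coe_toNNReal _ hℓ.le] using this

end CutLinear

/-! ### Local form of the approximations -/

variable {F : E × E' → E →L[ℝ] E'} {Ψ : E → ℝ} {v : ι → E} {lam : ℝ} {K : Set E}

lemma tangent_child_sub (ℓ : ℝ) (p : E × E') (e : ι) (x : E) :
    tangent F (child F v ℓ p e) x - tangent F p x =
      (F (child F v ℓ p e) - F p) (x - (p.1 + ℓ • v e)) := by
  simp only [tangent, child, map_sub, map_add, _root_.sub_apply]
  abel

lemma contDiff_tangent (p : E × E') : ContDiff ℝ ∞ (tangent F p) := by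
  unfold tangent
  fun_prop

lemma hasFDerivAt_tangent (p : E × E') (x : E) : HasFDerivAt (tangent F p) (F p) x := by
  have := ((F p).hasFDerivAt.comp x ((hasFDerivAt_id x).sub_const p.1)).const_add p.2
  exact this

lemma fderiv_tangent (p : E × E') : fderiv ℝ (tangent F p) = fun _ => F p :=
  funext fun x => (hasFDerivAt_tangent p x).fderiv

lemma eventually_profile_eq_zero {y w : E} (ℓ : ℝ) {c x : E} (hy : y = ℓ⁻¹ • (x - c) - w)
    (h : y ∉ tsupport Ψ) : ∀ᶠ z in 𝓝 x, Ψ (ℓ⁻¹ • (z - c) - w) = 0 := by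
  subst hy
  have hc : ContinuousAt (fun z : E => ℓ⁻¹ • (z - c) - w) x := by fun_prop
  exact hc.eventually (notMem_tsupport_iff_eventuallyEq.1 h)

lemma cutLinear_child {ℓ : ℝ} (hℓ : 0 < ℓ) (p : E × E') (e : ι) (z : E) :
    Ψ (ℓ⁻¹ • (z - p.1) - v e) • (tangent F (child F v ℓ p e) z - tangent F p z) =
      cutLinear Ψ (F (child F v ℓ p e) - F p) ℓ (p.1 + ℓ • v e) z := by
  rw [tangent_child_sub, cutLinear]
  congr 2
  rw [← sub_sub, smul_sub ℓ⁻¹ _ (ℓ • v e), smul_smul, inv_mul_cancel₀ hℓ.ne', one_smul]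

variable [Fintype ι]

lemma contDiff_approx (hΨ : ContDiff ℝ ∞ Ψ) (N : ℕ) (ℓ : ℝ) (p : E × E') :
    ContDiff ℝ ∞ (approx F Ψ v lam N ℓ p) := by
  induction N generalizing ℓ p with
  | zero => exact contDiff_tangent p
  | succ N ih =>
    have h1 := contDiff_tangent (F := F) p
    have h2 := fun e => ih (lam * ℓ) (child F v ℓ p e)
    change ContDiff ℝ ∞ fun x => tangent F p x + ∑ e, Ψ (ℓ⁻¹ • (x - p.1) - v e) •
      (approx F Ψ v lam N (lam * ℓ) (child F v ℓ p e) x - tangent F p x)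
    refine h1.add (ContDiff.sum fun e _ => ContDiff.smul ?_ ((h2 e).sub h1))
    fun_prop

lemma approx_eq_tangent_of_notMem (ℓ : ℝ) (p : E × E') (x : E)
    (h : ∀ e, ℓ⁻¹ • (x - p.1) - v e ∉ tsupport Ψ) (N : ℕ) :
    approx F Ψ v lam N ℓ p =ᶠ[𝓝 x] tangent F p := by
  cases N with
  | zero => exact EventuallyEq.rfl
  | succ N =>
    have : ∀ᶠ z in 𝓝 x, ∀ e, Ψ (ℓ⁻¹ • (z - p.1) - v e) = 0 :=
      eventually_all.2 fun e => eventually_profile_eq_zero ℓ rfl (h e)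
    filter_upwards [this] with z hz
    simp [approx, hz]

lemma approx_succ_of_mem (hP : IsProfile K v lam Ψ) (ℓ : ℝ) (p : E × E') (x : E) (e : ι)
    (h : ℓ⁻¹ • (x - p.1) - v e ∈ tsupport Ψ) (N : ℕ) :
    approx F Ψ v lam (N + 1) ℓ p =ᶠ[𝓝 x] fun z => tangent F p z + Ψ (ℓ⁻¹ • (z - p.1) - v e) •
      (approx F Ψ v lam N (lam * ℓ) (child F v ℓ p e) z - tangent F p z) := by
  have : ∀ᶠ z in 𝓝 x, ∀ e', e' ≠ e → Ψ (ℓ⁻¹ • (z - p.1) - v e') = 0 := by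
    refine eventually_all.2 fun e' => ?_
    by_cases he : e' = e
    · simp [he]
    · filter_upwards [eventually_profile_eq_zero (Ψ := Ψ) ℓ rfl
        (fun h' => he (hP.disj _ _ _ h' h))] with z hz _ using hz
  filter_upwards [this] with z hz
  simp only [approx]
  rw [Finset.sum_eq_single e (fun e' _ he => by simp [hz e' he]) (by simp)]

lemma approx_one_local (hP : IsProfile K v lam Ψ) {ℓ : ℝ} (hℓ : 0 < ℓ) (p : E × E') (x : E) :
    approx F Ψ v lam 1 ℓ p =ᶠ[𝓝 x] tangent F p ∨
    ∃ e, approx F Ψ v lam 1 ℓ p =ᶠ[𝓝 x] fun z => tangent F p z +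
      cutLinear Ψ (F (child F v ℓ p e) - F p) ℓ (p.1 + ℓ • v e) z := by
  by_cases h : ∀ e, ℓ⁻¹ • (x - p.1) - v e ∉ tsupport Ψ
  · exact .inl (approx_eq_tangent_of_notMem ℓ p x h 1)
  · push Not at h
    obtain ⟨e, he⟩ := h
    refine .inr ⟨e, (approx_succ_of_mem hP ℓ p x e he 0).trans (.of_eq ?_)⟩
    ext z
    rw [← cutLinear_child hℓ]
    rfl

lemma approx_succ_of_mem_smul (hP : IsProfile K v lam Ψ) (ℓ : ℝ) (p : E × E') (x : E) (e : ι)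
    {y : E} (hy : y ∈ K) (h : ℓ⁻¹ • (x - p.1) - v e = lam • y) (N : ℕ) :
    approx F Ψ v lam (N + 1) ℓ p =ᶠ[𝓝 x] approx F Ψ v lam N (lam * ℓ) (child F v ℓ p e) := by
  have h1 := hP.one y hy
  have hmem : ℓ⁻¹ • (x - p.1) - v e ∈ tsupport Ψ := by
    rw [h]
    refine subset_tsupport _ ?_
    simp [h1.self_of_nhds]
  have hc : ContinuousAt (fun z : E => ℓ⁻¹ • (z - p.1) - v e) x := by fun_prop
  rw [← h] at h1
  filter_upwards [approx_succ_of_mem hP ℓ p x e hmem N, hc.eventually h1] with z hz hz1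
  rw [hz, hz1]
  simp

/-- Near each point, either all approximations are the initial affine map, or they coincide with
the approximations started at one child, or they are in the transition zone of one child, where
they no longer depend on the order. -/
lemma approx_local (hP : IsProfile K v lam Ψ) {ℓ : ℝ} (hℓ : 0 < ℓ) (p : E × E') (x : E) :
    (∀ N, approx F Ψ v lam N ℓ p =ᶠ[𝓝 x] tangent F p) ∨
    (∃ e, ∀ N, approx F Ψ v lam (N + 1) ℓ p =ᶠ[𝓝 x]
      approx F Ψ v lam N (lam * ℓ) (child F v ℓ p e)) ∨
    ∃ e, ∀ N, approx F Ψ v lam (N + 1) ℓ p =ᶠ[𝓝 x] fun z => tangent F p z +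
      cutLinear Ψ (F (child F v ℓ p e) - F p) ℓ (p.1 + ℓ • v e) z := by
  by_cases h : ∀ e, ℓ⁻¹ • (x - p.1) - v e ∉ tsupport Ψ
  · exact .inl (approx_eq_tangent_of_notMem ℓ p x h)
  push Not at h
  obtain ⟨e, he⟩ := h
  right
  have hl := hP.lam_pos.ne'
  set y := lam⁻¹ • (ℓ⁻¹ • (x - p.1) - v e) with hy
  have hy' : ℓ⁻¹ • (x - p.1) - v e = lam • y := by rw [hy, smul_smul, mul_inv_cancel₀ hl, one_smul]
  by_cases hK : y ∈ K
  · exact .inl ⟨e, approx_succ_of_mem_smul hP ℓ p x e hK hy'⟩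
  · refine .inr ⟨e, fun N => ?_⟩
    -- Outside `lam • K` the cut-offs of the grandchildren vanish.
    have hout : ∀ e', (lam * ℓ)⁻¹ • (x - (child F v ℓ p e).1) - v e' ∉ tsupport Ψ := by
      intro e' he'
      apply hK
      have := hP.maps e' _ he'
      rw [sub_add_cancel] at this
      convert this using 1
      rw [hy, child, mul_inv, mul_smul, ← sub_sub, smul_sub ℓ⁻¹ _ (ℓ • v e), smul_smul ℓ⁻¹,
        inv_mul_cancel₀ hℓ.ne', one_smul]
    filter_upwards [approx_succ_of_mem hP ℓ p x e he N,
      approx_eq_tangent_of_notMem (F := F) (lam := lam) _ _ x hout N] with z h1 h2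
    rw [h1, h2, cutLinear_child hℓ]

/-! ### Uniform estimates -/

/-- The slope changes by at most a multiple of `ℓ` from a point to its children, as these lie at
distance `O(ℓ)` on a graph of bounded slope. -/
lemma exists_slope_bound (v : ι → E) {KF : ℝ≥0} (hF : LipschitzWith KF F) {M : ℝ}
    (hM : ∀ p, ‖F p‖ ≤ M) :
    ∃ B : ℝ≥0, ∀ ℓ : ℝ, 0 < ℓ → ∀ p e, ‖F (child F v ℓ p e) - F p‖ ≤ B * ℓ := by
  have hM0 : 0 ≤ M := (norm_nonneg _).trans (hM 0)
  lift M to ℝ≥0 using hM0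
  set R : ℝ≥0 := ∑ e, ‖v e‖₊
  refine ⟨KF * ((1 + M) * R), fun ℓ hℓ p e => ?_⟩
  have hv : ‖v e‖ ≤ R := by
    rw [← coe_nnnorm, NNReal.coe_le_coe]
    exact Finset.single_le_sum (f := fun e => ‖v e‖₊) (fun _ _ => zero_le) (Finset.mem_univ e)
  have h1 : ‖ℓ • v e‖ ≤ ℓ * R := by
    rw [norm_smul, Real.norm_eq_abs, abs_of_pos hℓ]
    gcongr
  have h2 : ‖F p (ℓ • v e)‖ ≤ M * (ℓ * R) := ((F p).le_opNorm _).trans (by gcongr; exact hM p)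
  have h3 : dist (child F v ℓ p e) p ≤ (1 + M) * (ℓ * R) := by
    have hpos : (0 : ℝ) ≤ ℓ * R := by positivity
    have hpos' : (0 : ℝ) ≤ M * (ℓ * R) := by positivity
    rw [Prod.dist_eq, dist_eq_norm, dist_eq_norm]
    simp only [child, add_sub_cancel_left]
    exact max_le (by linarith) (by linarith)
  rw [← dist_eq_norm]
  calc _ ≤ KF * dist (child F v ℓ p e) p := hF.dist_le_mul _ _
    _ ≤ KF * ((1 + M) * (ℓ * R)) := by gcongr
    _ = _ := by push_cast; ring

lemma fderiv_add_cutLinear (hΨ : ContDiff ℝ ∞ Ψ) (p : E × E') (T : E →L[ℝ] E') (ℓ : ℝ) (c : E) :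
    fderiv ℝ (fun z => tangent F p z + cutLinear Ψ T ℓ c z) =
      fun z => F p + fderiv ℝ (cutLinear Ψ T ℓ c) z := by
  ext1 z
  rw [fderiv_fun_add ((contDiff_tangent p).differentiable (by simp) z)
    ((contDiff_cutLinear hΨ T ℓ c).differentiable (by simp) z), fderiv_tangent]

/-- The second derivatives are bounded uniformly in the order, and the approximations and their
derivatives converge geometrically. By `approx_local`, each point sees at most one transition zone,
and there the slope jump, of size `ℓ`, is spread over a distance `ℓ`. -/
lemma exists_fderiv_fderiv_bound (hP : IsProfile K v lam Ψ) {KF : ℝ≥0} (hF : LipschitzWith KF F)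
    {M : ℝ} (hM : ∀ p, ‖F p‖ ≤ M) :
    ∃ H : ℝ≥0, ∀ N ℓ, 0 < ℓ → ∀ p x,
      ‖fderiv ℝ (fderiv ℝ (approx F Ψ v lam N ℓ p)) x‖ ≤ H ∧
      ‖approx F Ψ v lam (N + 1) ℓ p x - approx F Ψ v lam N ℓ p x‖ ≤ H * (lam ^ N * ℓ) ^ 2 ∧
      ‖fderiv ℝ (approx F Ψ v lam (N + 1) ℓ p) x - fderiv ℝ (approx F Ψ v lam N ℓ p) x‖ ≤
        H * (lam ^ N * ℓ) := by
  obtain ⟨B, hB⟩ := exists_slope_bound v hF hM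
  obtain ⟨G, hG⟩ := exists_cutLinear_bound (E' := E') hP.smooth hP.compact
  have hl := hP.lam_pos
  have key : ∀ ℓ, 0 < ℓ → ∀ p e, (G : ℝ) * ‖F (child F v ℓ p e) - F p‖ ≤ G * B * ℓ := by
    intro ℓ hℓ p e
    rw [mul_assoc]
    gcongr
    exact hB ℓ hℓ p e
  have hflat : ∀ p x, ‖fderiv ℝ (fderiv ℝ (tangent F p)) x‖ ≤ (G * B : ℝ≥0) := by
    intro p x
    rw [fderiv_tangent]
    exact (norm_fderiv_le_of_lipschitz ℝ (LipschitzWith.const (F p))).trans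
      (NNReal.coe_le_coe.2 zero_le)
  have hjump : ∀ p T ℓ c x, ‖fderiv ℝ (fderiv ℝ fun z => tangent F p z + cutLinear Ψ T ℓ c z) x‖ =
      ‖fderiv ℝ (fderiv ℝ (cutLinear Ψ T ℓ c)) x‖ := by
    intro p T ℓ c x
    rw [fderiv_add_cutLinear hP.smooth]
    exact congrArg norm (fderiv_const_add (F p))
  refine ⟨G * B, fun N => ?_⟩
  induction N with
  | zero =>
    intro ℓ hℓ p x
    refine ⟨?_, ?_⟩
    · exact hflat p x
    · change ‖_ - tangent F p x‖ ≤ _ ∧ ‖_ - fderiv ℝ (tangent F p) x‖ ≤ _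
      rcases approx_one_local (F := F) hP hℓ p x with h | ⟨e, h⟩
      · rw [zero_add, h.self_of_nhds, h.fderiv_eq]
        simp only [sub_self, norm_zero]
        constructor <;> positivity
      · obtain ⟨h1, h2, -⟩ := hG (F (child F v ℓ p e) - F p) ℓ hℓ (p.1 + ℓ • v e) x
        rw [zero_add, h.self_of_nhds, h.fderiv_eq, fderiv_add_cutLinear hP.smooth, fderiv_tangent]
        simp only [add_sub_cancel_left, pow_zero, one_mul]
        have := key ℓ hℓ p e
        refine ⟨h1.trans ?_, h2.trans (by exact_mod_cast this)⟩
        calc _ ≤ G * B * ℓ * ℓ := by gcongr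
          _ = _ := by push_cast; ring
  | succ N ih =>
    intro ℓ hℓ p x
    rcases approx_local (F := F) hP hℓ p x with h | ⟨e, h⟩ | ⟨e, h⟩
    · rw [(h (N + 1)).fderiv.fderiv_eq, (h (N + 1)).self_of_nhds, (h (N + 1 + 1)).self_of_nhds,
        (h (N + 1)).fderiv_eq,
        (h (N + 1 + 1)).fderiv_eq]
      simp only [sub_self, norm_zero]
      exact ⟨hflat p x, by positivity, by positivity⟩
    · rw [(h N).fderiv.fderiv_eq, (h N).self_of_nhds, (h (N + 1)).self_of_nhds, (h N).fderiv_eq,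
        (h (N + 1)).fderiv_eq, pow_succ lam N, mul_assoc (lam ^ N)]
      exact ih (lam * ℓ) (by positivity) _ x
    · rw [(h N).fderiv.fderiv_eq, (h N).self_of_nhds, (h (N + 1)).self_of_nhds, (h N).fderiv_eq,
        (h (N + 1)).fderiv_eq]
      simp only [sub_self, norm_zero]
      refine ⟨?_, by positivity, by positivity⟩
      rw [hjump]
      refine (hG _ ℓ hℓ _ x).2.2.trans ?_
      rw [div_le_iff₀ hℓ]
      exact_mod_cast key ℓ hℓ p e

/-! ### The limit of the approximations -/

/-- Near a point of a set that is invariant under the iterated function system, the approximations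
are tangent maps based at ever closer points. -/
lemma approx_eq_tangent_of_invariant (hP : IsProfile K v lam Ψ) {S : Set E} (hSK : S ⊆ K)
    (hS : ∀ y ∈ S, ∃ e, ∃ y' ∈ S, y = v e + lam • y') {r : ℝ} (hr : ∀ y ∈ S, ‖y‖ ≤ r) (N : ℕ)
    {ℓ : ℝ} (hℓ : 0 < ℓ) (p : E × E') {y : E} (hy : y ∈ S) :
    ∃ q : E × E', approx F Ψ v lam N ℓ p =ᶠ[𝓝 (p.1 + ℓ • y)] tangent F q ∧
      ‖p.1 + ℓ • y - q.1‖ ≤ lam ^ N * ℓ * r := by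
  induction N generalizing ℓ p y with
  | zero =>
    refine ⟨p, EventuallyEq.rfl, ?_⟩
    rw [add_sub_cancel_left, norm_smul, Real.norm_eq_abs, abs_of_pos hℓ, pow_zero, one_mul]
    gcongr
    exact hr y hy
  | succ N ih =>
    obtain ⟨e, y', hy', rfl⟩ := hS y hy
    have hx : p.1 + ℓ • (v e + lam • y') = (child F v ℓ p e).1 + (lam * ℓ) • y' := by
      rw [child, smul_add, smul_smul, mul_comm ℓ lam, add_assoc]
    obtain ⟨q, hq, hq'⟩ := ih (mul_pos hP.lam_pos hℓ) (child F v ℓ p e) hy'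
    rw [hx]
    refine ⟨q, (approx_succ_of_mem_smul hP ℓ p _ e (hSK hy') ?_ N).trans hq, ?_⟩
    · rw [← hx, add_sub_cancel_left, smul_smul, inv_mul_cancel₀ hℓ.ne', one_smul,
        add_sub_cancel_left]
    · rwa [pow_succ, mul_assoc (lam ^ N)]

/-- The limit of the approximations solves `DU = F (x, U x)` on every bounded invariant set. -/
theorem exists_limit [CompleteSpace E'] (hP : IsProfile K v lam Ψ) {KF : ℝ≥0}
    (hF : LipschitzWith KF F) {M : ℝ} (hM : ∀ p, ‖F p‖ ≤ M) :
    ∃ H : ℝ≥0, ∀ ℓ, 0 < ℓ → ℓ ≤ 1 → ∀ p, ∃ U : E → E', Differentiable ℝ U ∧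
      LipschitzWith H (fderiv ℝ U) ∧ (∀ x, ‖U x - tangent F p x‖ ≤ H * ℓ) ∧
      (∀ x, ‖fderiv ℝ U x - F p‖ ≤ H * ℓ) ∧
      (∀ x, ℓ⁻¹ • (x - p.1) ∉ K → U x = tangent F p x) ∧
      ∀ S ⊆ K, (∀ y ∈ S, ∃ e, ∃ y' ∈ S, y = v e + lam • y') → ∀ r, (∀ y ∈ S, ‖y‖ ≤ r) →
        ∀ y ∈ S, fderiv ℝ U (p.1 + ℓ • y) = F (p.1 + ℓ • y, U (p.1 + ℓ • y)) := by
  obtain ⟨H, hH⟩ := exists_fderiv_fderiv_bound hP hF hM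
  have hl := hP.lam_pos
  have hl1 := hP.lam_lt
  have hl2 : 0 < 1 - lam := by linarith
  have hM0 : 0 ≤ M := (norm_nonneg _).trans (hM 0)
  set δ : ℝ≥0 := (1 - lam).toNNReal with hδ
  have hδ' : (δ : ℝ) = 1 - lam := Real.coe_toNNReal _ hl2.le
  refine ⟨H + H / δ, fun ℓ hℓ hℓ1 p => ?_⟩
  set f : ℕ → E → E' := fun N => approx F Ψ v lam N ℓ p with hf
  have hfs : ∀ N, ContDiff ℝ ∞ (f N) := fun N => contDiff_approx hP.smooth N ℓ p
  have hfd : ∀ N, Differentiable ℝ (f N) := fun N => (hfs N).differentiable (by simp)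
  have d0 : ∀ N x, dist (f N x) (f (N + 1) x) ≤ H * ℓ * lam ^ N := by
    intro N x
    rw [dist_comm, dist_eq_norm]
    refine (hH N ℓ hℓ p x).2.1.trans ?_
    have h1 : lam ^ N * ℓ ≤ 1 := mul_le_one₀ (pow_le_one₀ hl.le hl1.le) hℓ.le hℓ1
    have h2 : (lam ^ N * ℓ) ^ 2 ≤ lam ^ N * ℓ := by
      have : 0 ≤ lam ^ N * ℓ := by positivity
      nlinarith
    calc _ ≤ H * (lam ^ N * ℓ) := by gcongr
      _ = _ := by ring
  have d1 : ∀ N x, dist (fderiv ℝ (f N) x) (fderiv ℝ (f (N + 1)) x) ≤ H * ℓ * lam ^ N := by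
    intro N x
    rw [dist_comm, dist_eq_norm]
    exact (hH N ℓ hℓ p x).2.2.trans (le_of_eq (by ring))
  choose U hU using fun x => cauchySeq_tendsto_of_complete
    (cauchySeq_of_le_geometric lam (H * ℓ) hl1 (fun N => d0 N x))
  choose U' hU' using fun x => cauchySeq_tendsto_of_complete
    (cauchySeq_of_le_geometric lam (H * ℓ) hl1 (fun N => d1 N x))
  have e1 : ∀ N x, dist (fderiv ℝ (f N) x) (U' x) ≤ H * ℓ * lam ^ N / (1 - lam) := fun N x =>
    dist_le_of_le_geometric_of_tendsto lam (H * ℓ) hl1 (fun N => d1 N x) (hU' x) N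
  have hunif : TendstoUniformly (fun N x => fderiv ℝ (f N) x) U' atTop := by
    have hlim : Tendsto (fun N => H * ℓ * lam ^ N / (1 - lam)) atTop (𝓝 0) := by
      have := ((tendsto_pow_atTop_nhds_zero_of_lt_one hl.le hl1).const_mul (H * ℓ)).div_const
        (1 - lam)
      simpa using this
    rw [Metric.tendstoUniformly_iff]
    intro ε hε
    filter_upwards [hlim.eventually (gt_mem_nhds hε)] with N hN x
    rw [dist_comm]
    exact (e1 N x).trans_lt hN
  have hder : ∀ x, HasFDerivAt U (U' x) x := fun x =>
    hasFDerivAt_of_tendstoUniformly hunif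
      (fun N x => (hfd N x).hasFDerivAt) hU x
  have hfU : fderiv ℝ U = U' := funext fun x => (hder x).fderiv
  have hbig : (H : ℝ) * ℓ / (1 - lam) ≤ (H + H / δ : ℝ≥0) * ℓ := by
    push_cast
    rw [hδ', add_mul, div_mul_eq_mul_div]
    have : 0 ≤ (H : ℝ) * ℓ := by positivity
    linarith
  refine ⟨U, fun x => (hder x).differentiableAt, ?_, ?_, ?_, ?_, ?_⟩
  · rw [hfU]
    have hlipN : ∀ N, LipschitzWith H (fderiv ℝ (f N)) := fun N =>
      lipschitzWith_of_nnnorm_fderiv_le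
        (((hfs N).fderiv_right (m := ∞) (by simp)).differentiable (by simp))
        fun x => (hH N ℓ hℓ p x).1
    have : LipschitzWith H U' := by
      refine LipschitzWith.of_dist_le_mul fun x y => ?_
      exact le_of_tendsto ((hU' x).dist (hU' y))
        (Eventually.of_forall fun N => (hlipN N).dist_le_mul x y)
    exact this.weaken le_self_add
  · intro x
    have := dist_le_of_le_geometric_of_tendsto₀ lam (H * ℓ) hl1 (fun N => d0 N x) (hU x)
    rw [dist_comm, dist_eq_norm] at this
    exact this.trans hbig
  · intro x
    have := dist_le_of_le_geometric_of_tendsto₀ lam (H * ℓ) hl1 (fun N => d1 N x) (hU' x)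
    rw [dist_comm, dist_eq_norm] at this
    have h0 : fderiv ℝ (f 0) x = F p := (hasFDerivAt_tangent p x).fderiv
    rw [h0] at this
    rw [hfU]
    exact this.trans hbig
  · intro x hx
    refine tendsto_nhds_unique (hU x) (tendsto_const_nhds.congr fun N => ?_)
    refine (approx_eq_tangent_of_notMem ℓ p x (fun e he => hx ?_) N).self_of_nhds.symm
    have := hP.maps e _ he
    rwa [sub_add_cancel] at this
  · intro S hSK hS r hr y hy
    set x := p.1 + ℓ • y with hx
    rw [hfU]
    have hcont : Continuous F := hF.continuous
    have hlim : Tendsto (fun N => dist (fderiv ℝ (f N) x) (F (x, f N x))) atTop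
        (𝓝 (dist (U' x) (F (x, U x)))) :=
      (hU' x).dist ((hcont.tendsto _).comp (tendsto_const_nhds.prodMk_nhds (hU x)))
    have hzero : Tendsto (fun N => KF * ((1 + M) * (lam ^ N * ℓ * r))) atTop (𝓝 0) := by
      have := ((((tendsto_pow_atTop_nhds_zero_of_lt_one hl.le hl1).mul_const ℓ).mul_const
        r).const_mul (1 + M)).const_mul (KF : ℝ)
      simpa using this
    refine dist_le_zero.1 (le_of_tendsto_of_tendsto hlim hzero (Eventually.of_forall fun N => ?_))
    -- The slope at `x` is `F q` for a point `q` of the graph close to `(x, f N x)`.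
    obtain ⟨q, hq, hq'⟩ := approx_eq_tangent_of_invariant (F := F) hP hSK hS hr N hℓ p hy
    have h1 : fderiv ℝ (f N) x = F q := by
      rw [hf]
      simp only
      rw [hq.fderiv_eq, fderiv_tangent]
    have h2 : f N x = tangent F q x := hq.self_of_nhds
    simp only
    rw [h1, h2]
    refine (hF.dist_le_mul _ _).trans ?_
    gcongr
    rw [dist_comm, Prod.dist_eq, dist_eq_norm, dist_eq_norm]
    have h3 : ‖F q (x - q.1)‖ ≤ M * ‖x - q.1‖ := ((F q).le_opNorm _).trans (by gcongr; exact hM q)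
    simp only [tangent, add_sub_cancel_left]
    have h4 := norm_nonneg (x - q.1)
    have h5 : 0 ≤ M * ‖x - q.1‖ := by positivity
    calc _ ≤ (1 + M) * ‖x - q.1‖ := max_le (by linarith) (by linarith)
      _ ≤ _ := by gcongr

end NestedInterpolation

namespace CantorDust

open Filter Topology Set MeasureTheory

/-! ### Symmetric Cantor sets on the line -/

/-- The point with address `a` of the Cantor set of ratio `lam` generated by the two maps
`x ↦ ±1/2 + lam * x`; the digits `0` and `1` stand for the signs. -/
noncomputable def codeSum (lam : ℝ) (a : ℕ → Fin 2) : ℝ :=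
  ∑' n, lam ^ n * (((a n : ℕ) : ℝ) - 1 / 2)

variable {lam : ℝ}

lemma abs_digit_le (x : Fin 2) : |((x : ℕ) : ℝ) - 1 / 2| ≤ 1 / 2 := by
  fin_cases x <;> norm_num [abs_le]

lemma norm_term_le (h0 : 0 < lam) (x : Fin 2) (n : ℕ) :
    ‖lam ^ n * (((x : ℕ) : ℝ) - 1 / 2)‖ ≤ lam ^ n * (1 / 2) := by
  rw [norm_mul, Real.norm_eq_abs, Real.norm_eq_abs, abs_of_pos (pow_pos h0 n)]
  have := abs_digit_le x
  gcongr

lemma summable_bound (h0 : 0 < lam) (h1 : lam < 1) : Summable fun n : ℕ => lam ^ n * (1 / 2) :=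
  (summable_geometric_of_lt_one h0.le h1).mul_right _

lemma summable_term (h0 : 0 < lam) (h1 : lam < 1) (a : ℕ → Fin 2) :
    Summable fun n => lam ^ n * (((a n : ℕ) : ℝ) - 1 / 2) :=
  (summable_bound h0 h1).of_norm_bounded fun n => norm_term_le h0 (a n) n

lemma codeSum_eq (h0 : 0 < lam) (h1 : lam < 1) (a : ℕ → Fin 2) :
    codeSum lam a = ((a 0 : ℕ) : ℝ) - 1 / 2 + lam * codeSum lam (fun n => a (n + 1)) := by
  rw [codeSum, (summable_term h0 h1 a).tsum_eq_zero_add, codeSum, ← tsum_mul_left]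
  simp [pow_succ', mul_assoc]

lemma abs_codeSum_le (h0 : 0 < lam) (h1 : lam < 1) (a : ℕ → Fin 2) :
    |codeSum lam a| ≤ (1 - lam)⁻¹ / 2 := by
  have := tsum_of_norm_bounded (f := fun n => lam ^ n * (((a n : ℕ) : ℝ) - 1 / 2))
    ((hasSum_geometric_of_lt_one h0.le h1).mul_right (1 / 2)) (fun n => norm_term_le h0 (a n) n)
  rw [Real.norm_eq_abs] at this
  rw [codeSum]
  linarith

lemma abs_codeSum_sub_le_inv (h0 : 0 < lam) (h1 : lam < 1) (a b : ℕ → Fin 2) :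
    |codeSum lam a - codeSum lam b| ≤ (1 - lam)⁻¹ := by
  have ha := abs_codeSum_le h0 h1 a
  have hb := abs_codeSum_le h0 h1 b
  rw [abs_le] at *
  constructor <;> linarith [ha.1, ha.2, hb.1, hb.2]

lemma abs_codeSum_sub_le (h0 : 0 < lam) (h1 : lam < 1) (n : ℕ) (a b : ℕ → Fin 2)
    (h : ∀ i < n, a i = b i) : |codeSum lam a - codeSum lam b| ≤ lam ^ n * (1 - lam)⁻¹ := by
  induction n generalizing a b with
  | zero => simpa using abs_codeSum_sub_le_inv h0 h1 a b
  | succ n ih =>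
    have := ih (fun i => a (i + 1)) (fun i => b (i + 1)) fun i hi => h (i + 1) (by lia)
    rw [codeSum_eq h0 h1 a, codeSum_eq h0 h1 b, h 0 (by lia), add_sub_add_left_eq_sub, ← mul_sub,
      abs_mul, abs_of_pos h0, pow_succ', mul_assoc]
    gcongr

/-- Addresses that first differ at the `n`-th digit belong to points at distance at least a
constant times `lam ^ n`. -/
lemma le_abs_codeSum_sub (h0 : 0 < lam) (h1 : lam < 1) (n : ℕ) (a b : ℕ → Fin 2)
    (h : ∀ i < n, a i = b i) (hn : a n ≠ b n) :
    lam ^ n * (1 - lam * (1 - lam)⁻¹) ≤ |codeSum lam a - codeSum lam b| := by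
  induction n generalizing a b with
  | zero =>
    rw [codeSum_eq h0 h1 a, codeSum_eq h0 h1 b]
    have h3 := abs_codeSum_sub_le_inv h0 h1 (fun n => a (n + 1)) (fun n => b (n + 1))
    have h4 : |lam * (codeSum lam (fun n => a (n + 1)) - codeSum lam (fun n => b (n + 1)))| ≤
        lam * (1 - lam)⁻¹ := by
      rw [abs_mul, abs_of_pos h0]
      gcongr
    have h5 : |((a 0 : ℕ) : ℝ) - ((b 0 : ℕ) : ℝ)| = 1 := by
      generalize a 0 = x at *
      generalize b 0 = y at *
      fin_cases x <;> fin_cases y <;> simp_all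
    have h6 := abs_sub_abs_le_abs_sub (((a 0 : ℕ) : ℝ) - ((b 0 : ℕ) : ℝ))
      (-(lam * (codeSum lam (fun n => a (n + 1)) - codeSum lam (fun n => b (n + 1)))))
    rw [abs_neg, h5] at h6
    rw [pow_zero, one_mul]
    refine (by linarith : _ ≤ _).trans (h6.trans (le_of_eq ?_))
    congr 1
    ring
  | succ n ih =>
    have := ih (fun i => a (i + 1)) (fun i => b (i + 1)) (fun i hi => h (i + 1) (by lia)) hn
    rw [codeSum_eq h0 h1 a, codeSum_eq h0 h1 b, h 0 (by lia), add_sub_add_left_eq_sub, ← mul_sub,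
      abs_mul, abs_of_pos h0, pow_succ', mul_assoc]
    gcongr

lemma continuous_codeSum (h0 : 0 < lam) (h1 : lam < 1) : Continuous (codeSum lam) := by
  refine continuous_tsum (fun n => ?_) (summable_bound h0 h1) fun n a => norm_term_le h0 (a n) n
  have : Continuous fun x : Fin 2 => ((x : ℕ) : ℝ) := continuous_of_discreteTopology
  fun_prop

/-- The Cantor function is Hölder continuous with exponent `r`, where `lam ^ r = 1 / 2`. -/
lemma exists_holder (h0 : 0 < lam) (h1 : lam < 1 / 2) {r : ℝ} (hr : 0 < r)
    (hlr : lam ^ r = 1 / 2) : ∃ D : ℝ≥0, ∀ a b : ℕ → Fin 2,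
      |Real.ofDigits a - Real.ofDigits b| ≤ D * |codeSum lam a - codeSum lam b| ^ r := by
  have hc : 0 < 1 - lam * (1 - lam)⁻¹ := by
    rw [← div_eq_mul_inv, sub_pos, div_lt_one] <;> linarith
  set c := 1 - lam * (1 - lam)⁻¹
  refine ⟨⟨(c ^ r)⁻¹, by positivity⟩, fun a b => ?_⟩
  by_cases hab : a = b
  · subst hab
    simp [Real.zero_rpow hr.ne']
  · have hex : ∃ n, a n ≠ b n := Function.ne_iff.1 hab
    classical
    set n := Nat.find hex
    have hlt : ∀ i < n, a i = b i := fun i hi => not_not.1 (Nat.find_min hex hi)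
    have hA := Real.abs_ofDigits_sub_ofDigits_le hlt
    have hB := le_abs_codeSum_sub h0 (by linarith) n a b hlt (Nat.find_spec hex)
    refine hA.trans ?_
    have h3 : (lam ^ n * c) ^ r = ((2 : ℝ) ^ n)⁻¹ * c ^ r := by
      rw [Real.mul_rpow (by positivity) hc.le, ← Real.rpow_natCast lam n, ← Real.rpow_mul h0.le,
        mul_comm (n : ℝ) r, Real.rpow_mul h0.le, hlr, Real.rpow_natCast]
      simp
    have h4 : (lam ^ n * c) ^ r ≤ |codeSum lam a - codeSum lam b| ^ r := by gcongr
    rw [h3] at h4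
    change _ ≤ (c ^ r)⁻¹ * _
    rw [inv_mul_eq_div, le_div_iff₀ (by positivity)]
    exact_mod_cast h4

/-! ### Products of Cantor sets -/

/-- The point with address `ω` of the product of `k` copies of the Cantor set of ratio `lam`. -/
noncomputable def cantorPoint (lam : ℝ) {k : ℕ} (ω : ℕ → Fin k → Fin 2) : Fin k → ℝ :=
  fun i => codeSum lam fun n => ω n i

variable {k : ℕ}

lemma isCompact_range_cantorPoint (h0 : 0 < lam) (h1 : lam < 1) :
    IsCompact (range (cantorPoint lam (k := k))) := by
  refine isCompact_range (continuous_pi fun i => (continuous_codeSum h0 h1).comp ?_)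
  fun_prop

/-- The `2 ^ (k * n)` sets of points whose first `n` digits are prescribed cover the dust, and the
sum of the `d`-th powers of their diameters is bounded independently of `n`. -/
lemma dimH_range_cantorPoint_le (h0 : 0 < lam) (h1 : lam < 1 / 2) {d : ℝ} (hd : 0 < d)
    (hld : lam ^ d = (1 / 2) ^ k) :
    dimH (range (cantorPoint lam (k := k))) ≤ ENNReal.ofReal d := by
  have hpos : (0 : ℝ) < 1 - lam := by linarith
  set q := (1 - lam)⁻¹ with hq
  have hqpos : 0 < q := inv_pos.2 hpos
  set t : ∀ n : ℕ, (Fin n → Fin k → Fin 2) → Set (Fin k → ℝ) :=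
    fun n w => cantorPoint lam '' {ω | ∀ i : Fin n, ω i = w i}
  have hdiam : ∀ n w, Metric.ediam (t n w) ≤ ENNReal.ofReal (lam ^ n * q) := by
    intro n w
    refine Metric.ediam_le ?_
    rintro _ ⟨ω, hω, rfl⟩ _ ⟨ω', hω', rfl⟩
    refine edist_pi_le_iff.2 fun i => ?_
    rw [edist_dist, Real.dist_eq]
    refine ENNReal.ofReal_le_ofReal (abs_codeSum_sub_le h0 (by linarith) n _ _ fun j hj => ?_)
    rw [hω ⟨j, hj⟩, hω' ⟨j, hj⟩]
  have hsum : ∀ n, ∑ w, Metric.ediam (t n w) ^ d ≤ ENNReal.ofReal (q ^ d) := by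
    intro n
    have hterm : ∀ w, Metric.ediam (t n w) ^ d ≤
        ENNReal.ofReal (((1 / 2 : ℝ) ^ k) ^ n * q ^ d) := by
      intro w
      refine (ENNReal.rpow_le_rpow (hdiam n w) hd.le).trans (le_of_eq ?_)
      rw [ENNReal.ofReal_rpow_of_nonneg (by positivity) hd.le,
        Real.mul_rpow (by positivity) hqpos.le, ← Real.rpow_natCast lam n, ← Real.rpow_mul h0.le,
        mul_comm (n : ℝ) d, Real.rpow_mul h0.le, hld, Real.rpow_natCast]
    refine (Finset.sum_le_card_nsmul _ _ _ fun w _ => hterm w).trans (le_of_eq ?_)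
    rw [nsmul_eq_mul, ← ENNReal.ofReal_natCast, ← ENNReal.ofReal_mul (by positivity), ← mul_assoc]
    congr 1
    simp
  have hμ := Measure.hausdorffMeasure_le_liminf_sum d (range (cantorPoint lam (k := k)))
    (l := atTop) (fun n : ℕ => ENNReal.ofReal (lam ^ n * q)) (by
      have := ENNReal.tendsto_ofReal
        ((tendsto_pow_atTop_nhds_zero_of_lt_one h0.le (by linarith : lam < 1)).mul_const q)
      simpa using this) t (Eventually.of_forall hdiam) (Eventually.of_forall fun n => by
      rintro _ ⟨ω, rfl⟩
      exact mem_iUnion.2 ⟨fun i => ω i, ω, fun i => rfl, rfl⟩)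
  refine dimH_le_of_hausdorffMeasure_ne_top (d := d.toNNReal) ?_
  rw [Real.coe_toNNReal _ hd.le]
  refine ne_top_of_le_ne_top ENNReal.ofReal_ne_top (hμ.trans ((liminf_le_liminf
    (Eventually.of_forall hsum)).trans (le_of_eq (liminf_const _))))

/-- The coordinatewise Cantor function maps the Cantor dust onto a cube, which has dimension
`k`. -/
lemma le_dimH_range_cantorPoint (hk : 0 < k) (h0 : 0 < lam) (h1 : lam < 1 / 2) {d : ℝ}
    (hd : 0 < d) (hld : lam ^ d = (1 / 2) ^ k) :
    ENNReal.ofReal d ≤ dimH (range (cantorPoint lam (k := k))) := by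
  have hk' : (0 : ℝ) < k := by exact_mod_cast hk
  set r : ℝ := d / k with hr
  have hrpos : 0 < r := by positivity
  have hlr : lam ^ r = 1 / 2 := by
    rw [hr, div_eq_mul_inv, Real.rpow_mul h0.le, hld, Real.pow_rpow_inv_natCast (by norm_num) hk.ne']
  obtain ⟨D, hD⟩ := exists_holder h0 h1 hrpos hlr
  set S := range (cantorPoint lam (k := k))
  set ψ : (ℕ → Fin k → Fin 2) → Fin k → ℝ := fun ω i => Real.ofDigits fun n => ω n i
  have hψ : ∀ ω ω', edist (ψ ω) (ψ ω') ≤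
      D * edist (cantorPoint lam ω) (cantorPoint lam ω') ^ r := by
    intro ω ω'
    refine edist_pi_le_iff.2 fun i => ?_
    refine le_trans ?_ (mul_le_mul_right (ENNReal.rpow_le_rpow (edist_le_pi_edist _ _ i) hrpos.le) _)
    rw [edist_dist, edist_dist, ENNReal.ofReal_rpow_of_nonneg dist_nonneg hrpos.le,
      ← ENNReal.ofReal_coe_nnreal, ← ENNReal.ofReal_mul D.coe_nonneg]
    exact ENNReal.ofReal_le_ofReal (hD _ _)
  choose! g hg using fun x (hx : x ∈ S) => hx
  have hhol : HolderOnWith D r.toNNReal (ψ ∘ g) S := by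
    intro x hx y hy
    have := hψ (g x) (g y)
    rw [hg x hx, hg y hy] at this
    rwa [Real.coe_toNNReal _ hrpos.le]
  have himg : Set.pi univ (fun _ : Fin k => Icc (0 : ℝ) 1) ⊆ (ψ ∘ g) '' S := by
    intro z hz
    choose a ha using fun i => Real.ofDigits_SurjOn (b := 2) (by norm_num) (hz i (mem_univ i))
    set ω : ℕ → Fin k → Fin 2 := fun n i => a i n
    refine ⟨cantorPoint lam ω, ⟨ω, rfl⟩, ?_⟩
    have h2 := hψ (g (cantorPoint lam ω)) ω
    rw [hg _ ⟨ω, rfl⟩, edist_self, ENNReal.zero_rpow_of_pos hrpos, mul_zero, nonpos_iff_eq_zero,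
      edist_eq_zero] at h2
    refine h2.trans (funext fun i => (ha i).2)
  have hdim : dimH (Set.pi univ (fun _ : Fin k => Icc (0 : ℝ) 1)) = k := by
    rw [Real.dimH_of_nonempty_interior, Module.finrank_fin_fun]
    refine ⟨fun _ => 1 / 2, ?_⟩
    rw [interior_pi_set finite_univ]
    intro i _
    simp only [interior_Icc]
    norm_num
  have h5 : (k : ℝ≥0∞) ≤ dimH S / r.toNNReal := by
    rw [← hdim]
    exact (dimH_mono himg).trans (hhol.dimH_image_le (Real.toNNReal_pos.2 hrpos))
  rw [ENNReal.le_div_iff_mul_le (.inl (by simpa using hrpos)) (.inl (by simp))] at h5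
  refine le_trans (le_of_eq ?_) h5
  change _ = (k : ℝ≥0∞) * ENNReal.ofReal r
  rw [← ENNReal.ofReal_natCast, ← ENNReal.ofReal_mul hk'.le, hr, mul_div_cancel₀ _ hk'.ne']

end CantorDust

/-! ### Solutions on invariant sets -/

/-- The restriction of a Lipschitz map to a smaller ball extends to a bounded Lipschitz map: take
the value `0` far away, and extend across the gap in between. -/
lemma LipschitzOnWith.exists_bounded_extension {α W : Type*} [PseudoMetricSpace α]
    [NormedAddCommGroup W] [NormedSpace ℝ W] [FiniteDimensional ℝ W] {f : α → W} {κ : ℝ≥0}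
    {p₀ : α} {δ : ℝ} (hδ : 0 < δ) (hf : LipschitzOnWith κ f (Metric.closedBall p₀ δ)) :
    ∃ g : α → W, (∃ κ', LipschitzWith κ' g) ∧ (∃ M, ∀ p, ‖g p‖ ≤ M) ∧
      ∀ p ∈ Metric.closedBall p₀ (δ / 2), g p = f p := by
  classical
  have hle : δ / 2 ≤ δ := by linarith
  set M : ℝ := ‖f p₀‖ + κ * δ with hM
  have hM0 : 0 ≤ M := by positivity
  have hfM : ∀ p ∈ Metric.closedBall p₀ δ, ‖f p‖ ≤ M := by
    intro p hp
    have h1 := hf.dist_le_mul p hp p₀ (Metric.mem_closedBall_self hδ.le)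
    have h2 : (κ : ℝ) * dist p p₀ ≤ κ * δ := by
      gcongr
      exact hp
    have h3 := norm_le_norm_add_norm_sub' (f p) (f p₀)
    rw [dist_eq_norm] at h1
    linarith
  set L : ℝ≥0 := κ + (2 * M / δ).toNNReal
  have hL : (L : ℝ) = κ + 2 * M / δ := by
    rw [NNReal.coe_add, Real.coe_toNNReal _ (by positivity)]
  set h : α → W := fun p => if dist p p₀ ≤ δ / 2 then f p else 0 with hh
  set s : Set α := {p | dist p p₀ ≤ δ / 2 ∨ δ ≤ dist p p₀} with hs
  have key : ∀ x y, dist x p₀ ≤ δ / 2 → δ ≤ dist y p₀ → ‖f x‖ ≤ L * dist x y := by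
    intro x y hx hy
    have h1 : δ / 2 ≤ dist x y := by
      have := dist_triangle y x p₀
      rw [dist_comm y x] at this
      linarith
    calc ‖f x‖ ≤ M := hfM x (hx.trans hle)
      _ = 2 * M / δ * (δ / 2) := by field_simp
      _ ≤ L * dist x y := by
        rw [hL]
        gcongr
        linarith [κ.coe_nonneg]
  have hlip : LipschitzOnWith L h s := by
    refine LipschitzOnWith.of_dist_le_mul fun x hx y hy => ?_
    rcases hx with hx | hx <;> rcases hy with hy | hy
    · rw [hh]
      simp only [hx, hy, if_true]
      refine (hf.dist_le_mul x (hx.trans hle) y (hy.trans hle)).trans ?_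
      gcongr
      exact le_self_add
    · rw [hh]
      simp only [hx, if_true, (by linarith : ¬ dist y p₀ ≤ δ / 2), if_false, dist_zero_right]
      exact key x y hx hy
    · rw [hh, dist_comm, dist_comm x y]
      simp only [hy, if_true, (by linarith : ¬ dist x p₀ ≤ δ / 2), if_false, dist_zero_right]
      exact key y x hy hx
    · rw [hh]
      simp only [(by linarith : ¬ dist x p₀ ≤ δ / 2), (by linarith : ¬ dist y p₀ ≤ δ / 2),
        if_false, dist_self]
      positivity
  obtain ⟨g, hg, hgs⟩ := hlip.extend_finite_dimension
  refine ⟨g, ⟨_, hg⟩, ⟨‖g p₀‖ + (lipschitzExtensionConstant W * L : ℝ≥0) * δ, fun p => ?_⟩, ?_⟩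
  · rcases le_total (dist p p₀) δ with hp | hp
    · have h1 := hg.dist_le_mul p p₀
      have h2 : ((lipschitzExtensionConstant W * L : ℝ≥0) : ℝ) * dist p p₀ ≤
          (lipschitzExtensionConstant W * L : ℝ≥0) * δ := by gcongr
      have h3 := norm_le_norm_add_norm_sub' (g p) (g p₀)
      rw [dist_eq_norm] at h1
      linarith
    · rw [← hgs (.inr hp), hh]
      simp only [(by linarith : ¬ dist p p₀ ≤ δ / 2), if_false, norm_zero]
      positivity
  · intro p hp
    rw [Metric.mem_closedBall] at hp
    rw [← hgs (.inl hp), hh]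
    simp only [hp, if_true]

namespace NestedInterpolation

open Filter Topology Set
open scoped ContDiff

variable {E E' ι : Type*} [NormedAddCommGroup E] [NormedSpace ℝ E] [FiniteDimensional ℝ E]
  [NormedAddCommGroup E'] [NormedSpace ℝ E'] [FiniteDimensional ℝ E'] [Fintype ι]
  {Ψ : E → ℝ} {v : ι → E} {lam : ℝ} {K : Set E}

/-- On a small homothetic copy of an invariant set, the equation `Du = F (x, u x)` has a solution
with a small sup norm and a small support and with a Lipschitz derivative. It is the limit of the
approximations, with the initial affine map cut off. -/
theorem exists_solution (hP : IsProfile K v lam Ψ) {Ω : Set E} (hΩ : IsOpen Ω) {x₀ : E}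
    (hx₀ : x₀ ∈ Ω) {F : E × E' → E →L[ℝ] E'} (hF : LocallyLipschitzOn (Ω ×ˢ univ) F) {η : ℝ}
    (hη : 0 < η) {S : Set E} (hSK : S ⊆ K)
    (hS : ∀ y ∈ S, ∃ e, ∃ y' ∈ S, y = v e + lam • y') :
    ∃ ρ : ℝ, 0 < ρ ∧ ∃ u : E → E', tsupport u ⊆ Ω ∧ (∀ x, ‖u x‖ ≤ η) ∧ Differentiable ℝ u ∧
      (∃ L : ℝ≥0, LipschitzWith L (fderiv ℝ u)) ∧ (∃ M, ∀ x, ‖fderiv ℝ u x‖ ≤ M) ∧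
      ∀ y ∈ S, x₀ + ρ • y ∈ Ω ∧ HasFDerivAt u (F (x₀ + ρ • y, u (x₀ + ρ • y))) (x₀ + ρ • y) := by
  have hl := hP.lam_pos
  have hl1 := hP.lam_lt
  set p : E × E' := (x₀, 0) with hp
  -- A small ball around `p` on which `F` is Lipschitz.
  obtain ⟨δ, hδ, κ, hκ, hδΩ⟩ : ∃ δ > 0, ∃ κ, LipschitzOnWith κ F (Metric.closedBall p δ) ∧
      Metric.closedBall x₀ δ ⊆ Ω := by
    obtain ⟨κ, t, ht, hκ⟩ := hF (x := p) ⟨hx₀, mem_univ _⟩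
    rw [(hΩ.prod isOpen_univ).nhdsWithin_eq ⟨hx₀, mem_univ _⟩] at ht
    obtain ⟨δ₁, h1, h1'⟩ := Metric.nhds_basis_closedBall.mem_iff.1 ht
    obtain ⟨δ₂, h2, h2'⟩ := Metric.nhds_basis_closedBall.mem_iff.1 (hΩ.mem_nhds hx₀)
    exact ⟨min δ₁ δ₂, lt_min h1 h2, κ,
      hκ.mono ((Metric.closedBall_subset_closedBall (min_le_left _ _)).trans h1'),
      (Metric.closedBall_subset_closedBall (min_le_right _ _)).trans h2'⟩
  obtain ⟨Fb, ⟨KF, hKF⟩, ⟨M, hM⟩, hFb⟩ := hκ.exists_bounded_extension hδ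
  have hM0 : 0 ≤ M := (norm_nonneg _).trans (hM p)
  obtain ⟨r, hr⟩ := hP.compact.isCompact.isBounded.exists_norm_le
  obtain ⟨G, hG⟩ := exists_cutLinear_bound (E' := E') hP.smooth hP.compact
  obtain ⟨H, hH⟩ := exists_limit hP hKF hM
  set Q : ℝ := 1 + |r| + G * M + H with hQ
  have hQ1 : 1 ≤ Q := by
    have h1 : 0 ≤ G * M := by positivity
    linarith [abs_nonneg r, H.coe_nonneg]
  obtain ⟨ρ, hρ, hρ1, hρη, hρδ⟩ : ∃ ρ : ℝ, 0 < ρ ∧ ρ ≤ 1 ∧ ρ * Q ≤ η ∧ ρ * Q ≤ δ / 2 := by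
    refine ⟨min 1 (min η (δ / 2) / Q), by positivity, min_le_left _ _, ?_, ?_⟩
    · exact ((le_div_iff₀ (by positivity)).1 (min_le_right _ _)).trans (min_le_left _ _)
    · exact ((le_div_iff₀ (by positivity)).1 (min_le_right _ _)).trans (min_le_right _ _)
  have hρr : ρ * |r| ≤ ρ * Q := by
    have h1 : 0 ≤ G * M := by positivity
    gcongr
    linarith [H.coe_nonneg]
  have hlρ : 0 < lam * ρ := by positivity
  have hlρ1 : lam * ρ ≤ 1 := mul_le_one₀ hl1.le hρ.le hρ1
  obtain ⟨U, hUd, hUlip, hU0, hU1, hUout, hUS⟩ := hH (lam * ρ) hlρ hlρ1 p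
  set w : E → E' := cutLinear Ψ (Fb p) ρ x₀ with hw
  have hws : ContDiff ℝ ∞ w := contDiff_cutLinear hP.smooth _ _ _
  have hwd : Differentiable ℝ w := hws.differentiable (by simp)
  have hwG : ∀ x, ‖w x‖ ≤ G * M * ρ ∧ ‖fderiv ℝ w x‖ ≤ G * M ∧
      ‖fderiv ℝ (fderiv ℝ w) x‖ ≤ G * M / ρ := by
    intro x
    obtain ⟨h1, h2, h3⟩ := hG (Fb p) ρ hρ x₀ x
    have h4 : G * ‖Fb p‖ ≤ G * M := by
      gcongr
      exact hM p
    exact ⟨h1.trans (by gcongr), h2.trans h4, h3.trans (by gcongr)⟩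
  set u : E → E' := fun x => w x + (U x - tangent Fb p x) with hu
  have hud : ∀ x, HasFDerivAt u (fderiv ℝ w x + (fderiv ℝ U x - Fb p)) x := fun x =>
    (hwd x).hasFDerivAt.add ((hUd x).hasFDerivAt.sub (hasFDerivAt_tangent p x))
  have hufd : fderiv ℝ u = fun x => fderiv ℝ w x + (fderiv ℝ U x - Fb p) :=
    funext fun x => (hud x).fderiv
  have hunorm : ∀ x, ‖u x‖ ≤ ρ * Q := by
    intro x
    have h1 : (H : ℝ) * (lam * ρ) ≤ H * ρ := by
      gcongr
      nlinarith
    have h2 : 0 ≤ ρ * |r| := by positivity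
    calc ‖u x‖ ≤ ‖w x‖ + ‖U x - tangent Fb p x‖ := norm_add_le _ _
      _ ≤ G * M * ρ + H * (lam * ρ) := add_le_add (hwG x).1 (hU0 x)
      _ ≤ ρ * Q := by
        rw [hQ]
        linarith
  have hballΩ : Metric.closedBall x₀ (ρ * |r|) ⊆ Ω :=
    (Metric.closedBall_subset_closedBall (by linarith)).trans hδΩ
  have hmemS : ∀ y ∈ K, lam • y ∈ tsupport Ψ := by
    intro y hy
    refine subset_tsupport _ ?_
    simp [(hP.one y hy).self_of_nhds]
  refine ⟨lam * ρ, hlρ, u, ?_, fun x => (hunorm x).trans hρη, fun x => (hud x).differentiableAt,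
    ?_, ?_, ?_⟩
  · refine subset_trans (closure_minimal (fun x hx => ?_) Metric.isClosed_closedBall) hballΩ
    by_contra hxb
    apply hx
    rw [Metric.mem_closedBall, dist_eq_norm, not_le] at hxb
    have h1 : ρ⁻¹ • (x - x₀) ∉ tsupport Ψ := by
      intro hmem
      have := (hr _ hmem).trans (le_abs_self r)
      rw [norm_smul, norm_inv, Real.norm_eq_abs, abs_of_pos hρ, inv_mul_le_iff₀ hρ] at this
      linarith
    have h2 : (lam * ρ)⁻¹ • (x - p.1) ∉ K := by
      intro hmem
      apply h1
      convert hmemS _ hmem using 1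
      rw [smul_smul, mul_inv, mul_inv_cancel_left₀ hl.ne']
    rw [hu]
    simp only
    rw [hUout x h2, sub_self, add_zero, hw, cutLinear, image_eq_zero_of_notMem_tsupport h1,
      zero_smul]
  · have hwlip : LipschitzWith (G * M / ρ).toNNReal (fderiv ℝ w) :=
      lipschitzWith_of_nnnorm_fderiv_le
        ((hws.fderiv_right (m := ∞) (by simp)).differentiable (by simp))
        fun x => NNReal.le_toNNReal_of_coe_le (hwG x).2.2
    refine ⟨(G * M / ρ).toNNReal + (H + 0), ?_⟩
    rw [hufd]
    exact hwlip.add (hUlip.sub (LipschitzWith.const _))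
  · refine ⟨G * M + H * (lam * ρ), fun x => ?_⟩
    rw [hufd]
    exact (norm_add_le _ _).trans (add_le_add (hwG x).2.1 (hU1 x))
  · intro y hy
    set x := x₀ + (lam * ρ) • y with hx
    have hxy : ρ⁻¹ • (x - x₀) = lam • y := by
      rw [hx, add_sub_cancel_left, smul_smul, mul_comm lam, inv_mul_cancel_left₀ hρ.ne']
    have hxb : x ∈ Metric.closedBall x₀ (ρ * |r|) := by
      have := (hr _ (hmemS y (hSK hy))).trans (le_abs_self r)
      rw [← hxy, norm_smul, norm_inv, Real.norm_eq_abs, abs_of_pos hρ, inv_mul_le_iff₀ hρ] at this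
      rwa [Metric.mem_closedBall, dist_eq_norm]
    refine ⟨hballΩ hxb, ?_⟩
    -- The cut-off equals `1` near the invariant set, so there the affine terms of `u` cancel.
    have huU : u =ᶠ[𝓝 x] U := by
      have hc : ContinuousAt (fun z : E => ρ⁻¹ • (z - x₀)) x := by fun_prop
      have h1 := hP.one y (hSK hy)
      rw [← hxy] at h1
      filter_upwards [hc.eventually h1] with z hz
      rw [hu, hw]
      simp [cutLinear, hz, tangent, hp]
    have h3 := hUS S hSK hS (r / lam) (fun z hz => by
      have := hr _ (hmemS z (hSK hz))
      rw [norm_smul, Real.norm_eq_abs, abs_of_pos hl] at this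
      rwa [le_div_iff₀ hl, mul_comm]) y hy
    change fderiv ℝ U x = Fb (x, U x) at h3
    rw [← huU.self_of_nhds, hFb] at h3
    · rw [← h3]
      exact (hUd x).hasFDerivAt.congr_of_eventuallyEq huU
    · rw [Metric.mem_closedBall, Prod.dist_eq, dist_eq_norm, dist_eq_norm]
      rw [Metric.mem_closedBall, dist_eq_norm] at hxb
      refine max_le (hxb.trans (hρr.trans hρδ)) ?_
      rw [hp]
      simpa using (hunorm x).trans hρδ

end NestedInterpolation

namespace CantorDust

open Filter Topology Set NestedInterpolation

variable {lam : ℝ} {k : ℕ}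

/-! ### Cantor dusts in Euclidean space -/

/-- Below the full dimension, every value is attained by a compact subset of a Cantor dust: by the
dust of ratio `2 ^ (-k / d)`, or by a point if `d = 0`. -/
lemma exists_dimH_eq {d : ℝ} (hd₀ : 0 ≤ d) (hd : d < k) :
    ∃ lam : ℝ, 0 < lam ∧ lam < 1 / 2 ∧ ∃ S ⊆ range (cantorPoint lam (k := k)),
      IsCompact S ∧ S.Nonempty ∧ dimH S = ENNReal.ofReal d := by
  have hk : (0 : ℝ) < k := hd₀.trans_lt hd
  rcases hd₀.eq_or_lt with rfl | hpos
  · exact ⟨1 / 3, by norm_num, by norm_num, {cantorPoint (1 / 3) fun _ _ => 0},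
      by simp, isCompact_singleton, singleton_nonempty _, by simp⟩
  · have h0 : (0 : ℝ) < (1 / 2) ^ (k / d) := by positivity
    have h1 : ((1 : ℝ) / 2) ^ (k / d) < 1 / 2 := by
      conv_rhs => rw [← Real.rpow_one (1 / 2 : ℝ)]
      exact Real.rpow_lt_rpow_of_exponent_gt (by norm_num) (by norm_num)
        ((one_lt_div hpos).2 hd)
    have hld : (((1 : ℝ) / 2) ^ (k / d)) ^ d = (1 / 2) ^ k := by
      rw [← Real.rpow_mul (by norm_num), div_mul_cancel₀ _ hpos.ne', Real.rpow_natCast]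
    exact ⟨_, h0, h1, _, Subset.rfl, isCompact_range_cantorPoint h0 (by linarith),
      range_nonempty _, le_antisymm (dimH_range_cantorPoint_le h0 h1 hpos hld)
        (le_dimH_range_cantorPoint (by exact_mod_cast hk) h0 h1 hpos hld)⟩

/-- The vector with coordinates `±1/2` whose signs are given by `e`. -/
noncomputable def corner (e : Fin k → Fin 2) : EuclideanSpace ℝ (Fin k) :=
  WithLp.toLp 2 fun i => ((e i : ℕ) : ℝ) - 1 / 2

/-- A product of bump functions on the line is a cut-off profile for the maps that generate the
Cantor dust: since `lam < 1 / 2`, there is room between the cubes of half-side `lam` and the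
dyadic subcubes, of half-side `1 / 2`, that contain them. -/
lemma exists_isProfile (h0 : 0 < lam) (h1 : lam < 1 / 2) :
    ∃ Ψ : EuclideanSpace ℝ (Fin k) → ℝ, IsProfile {y | ∀ i, |y i| ≤ 1} corner lam Ψ := by
  let b : ContDiffBump (0 : ℝ) :=
    ⟨(2 * lam + 1 / 2) / 3, (lam + 1) / 3, by linarith, by linarith⟩
  set Ψ : EuclideanSpace ℝ (Fin k) → ℝ := fun y => ∏ i, b (y i) with hΨ
  set Z : Set (EuclideanSpace ℝ (Fin k)) := {y | ∀ i, |y i| ≤ (lam + 1) / 3} with hZ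
  have hzero : ∀ y ∉ Z, Ψ y = 0 := by
    intro y hy
    simp only [hZ, mem_ofPred_eq, not_forall, not_le] at hy
    obtain ⟨i, hi⟩ := hy
    refine Finset.prod_eq_zero (Finset.mem_univ i) (b.zero_of_le_dist ?_)
    rw [Real.dist_eq, sub_zero]
    exact hi.le
  have hZcomp : IsCompact Z := by
    have h2 : IsCompact (Set.pi univ fun _ : Fin k => Icc (-((lam + 1) / 3)) ((lam + 1) / 3)) :=
      isCompact_univ_pi fun _ => isCompact_Icc
    convert (EuclideanSpace.equiv (Fin k) ℝ).toHomeomorph.isCompact_preimage.2 h2 using 1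
    ext y
    simp only [hZ, abs_le, mem_ofPred_eq, mem_preimage, mem_univ_pi, mem_Icc]
    rfl
  have hts : tsupport Ψ ⊆ Z :=
    closure_minimal (fun y hy => not_not.1 fun h => hy (hzero y h)) hZcomp.isClosed
  have hcorner : ∀ (e : Fin k → Fin 2) i, |(corner e) i| ≤ 1 / 2 := fun e i => abs_digit_le (e i)
  refine ⟨Ψ, h0, by linarith, ?_, HasCompactSupport.intro hZcomp hzero, ?_, ?_, ?_⟩
  · refine contDiff_prod fun i _ => b.contDiff.comp ?_
    fun_prop
  · intro y hy
    have h3 : ∀ᶠ z in 𝓝 (lam • y), ∀ i, b (z i) = 1 := by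
      refine eventually_all.2 fun i => ?_
      have hc : ContinuousAt (fun z : EuclideanSpace ℝ (Fin k) => z i) (lam • y) := by fun_prop
      refine hc.eventually (b.eventuallyEq_one_of_mem_ball ?_)
      rw [Metric.mem_ball, Real.dist_eq, sub_zero]
      change |lam * y i| < (2 * lam + 1 / 2) / 3
      rw [abs_mul, abs_of_pos h0]
      have h5 : lam * |y i| ≤ lam * 1 := by
        gcongr
        exact hy i
      linarith
    filter_upwards [h3] with z hz
    simp [hΨ, hz]
  · intro e y hy i
    have h4 := hts hy i
    have h5 := hcorner e i
    have h6 := abs_add_le (y i) ((corner e) i)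
    rw [PiLp.add_apply]
    linarith
  · intro e e' y hy hy'
    funext i
    have h4 := hts hy i
    have h5 := hts hy' i
    rw [PiLp.sub_apply, abs_le] at h4 h5
    change _ ≤ y i - (((e i : ℕ) : ℝ) - 1 / 2) ∧ y i - (((e i : ℕ) : ℝ) - 1 / 2) ≤ _ at h4
    change _ ≤ y i - (((e' i : ℕ) : ℝ) - 1 / 2) ∧ y i - (((e' i : ℕ) : ℝ) - 1 / 2) ≤ _ at h5
    obtain ⟨h6, h7⟩ := h4
    obtain ⟨h8, h9⟩ := h5
    generalize e i = a at *
    generalize e' i = c at *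
    fin_cases a <;> fin_cases c <;> first | rfl | (exfalso; norm_num at *; linarith)

lemma toLp_cantorPoint (h0 : 0 < lam) (h1 : lam < 1) (ω : ℕ → Fin k → Fin 2) :
    WithLp.toLp 2 (cantorPoint lam ω) =
      corner (ω 0) + lam • WithLp.toLp 2 (cantorPoint lam fun n => ω (n + 1)) := by
  ext i
  exact codeSum_eq h0 h1 fun n => ω n i

lemma abs_cantorPoint_le (h0 : 0 < lam) (h1 : lam < 1 / 2) (ω : ℕ → Fin k → Fin 2) (i : Fin k) :
    |cantorPoint lam ω i| ≤ 1 := by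
  refine (abs_codeSum_le h0 (by linarith) _).trans ?_
  have : (1 - lam)⁻¹ ≤ (1 / 2)⁻¹ := by
    gcongr
    linarith
  norm_num at this
  linarith

lemma dimH_image_homothety {E : Type*} [NormedAddCommGroup E] [NormedSpace ℝ E] (x : E) {ρ : ℝ}
    (hρ : ρ ≠ 0) (S : Set E) : dimH ((fun y => x + ρ • y) '' S) = dimH S := by
  have h : (fun y => x + ρ • y) '' S =
      IsometryEquiv.addLeft x ''
        (ContinuousLinearEquiv.smulLeft (R₁ := ℝ) (Units.mk0 ρ hρ) '' S) := by
    rw [image_image]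
    rfl
  rw [h, IsometryEquiv.dimH_image, ContinuousLinearEquiv.dimH_image]

end CantorDust

open CantorDust NestedInterpolation in
theorem mainTheorem9 (k m : ℕ) (η d : ℝ) (hη : 0 < η) (hd₀ : 0 ≤ d) (hd : d < (k : ℝ))
    (Ω : Set (EuclideanSpace ℝ (Fin k))) (hΩ_open : IsOpen Ω)
    (hΩ_bdd : Bornology.IsBounded Ω) (hΩ_ne : Ω.Nonempty)
    (F : EuclideanSpace ℝ (Fin k) × EuclideanSpace ℝ (Fin m) →
      (EuclideanSpace ℝ (Fin k) →L[ℝ] EuclideanSpace ℝ (Fin m)))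
    (hF : LocallyLipschitzOn (Ω ×ˢ (Set.univ : Set (EuclideanSpace ℝ (Fin m)))) F) :
    ∃ (C : Set (EuclideanSpace ℝ (Fin k)))
      (u : EuclideanSpace ℝ (Fin k) → EuclideanSpace ℝ (Fin m)),
      IsCompact C ∧ C.Nonempty ∧ C ⊆ Ω ∧
      tsupport u ⊆ Ω ∧ (∀ x, ‖u x‖ ≤ η) ∧
      (∀ x ∈ C, HasFDerivAt u (F (x, u x)) x) ∧
      dimH C = ENNReal.ofReal d ∧
      IsC11On u Ω := by
  obtain ⟨x₀, hx₀⟩ := hΩ_ne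
  obtain ⟨lam, h0, h1, S, hS, hScomp, hSne, hSdim⟩ := exists_dimH_eq hd₀ hd
  obtain ⟨Ψ, hP⟩ := exists_isProfile (k := k) h0 h1
  set e := (EuclideanSpace.equiv (Fin k) ℝ).symm
  have hlt : lam < 1 := by linarith
  obtain ⟨ρ, hρ, u, husupp, hunorm, hud, ⟨L, hL⟩, ⟨M, hM⟩, hsol⟩ :=
    exists_solution hP hΩ_open hx₀ hF hη (S := e '' Set.range (cantorPoint lam)) (by
      rintro _ ⟨_, ⟨ω, rfl⟩, rfl⟩ i
      exact abs_cantorPoint_le h0 h1 ω i) (by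
      rintro _ ⟨_, ⟨ω, rfl⟩, rfl⟩
      exact ⟨ω 0, _, ⟨_, ⟨_, rfl⟩, rfl⟩, toLp_cantorPoint h0 hlt ω⟩)
  have hsub : e '' S ⊆ e '' Set.range (cantorPoint lam) := Set.image_mono hS
  refine ⟨(fun y => x₀ + ρ • y) '' (e '' S), u, ?_, (hSne.image _).image _, ?_, husupp, hunorm,
    ?_, ?_, ?_, ⟨max η M, fun x _ => ⟨(hunorm x).trans (le_max_left _ _),
      (hM x).trans (le_max_right _ _)⟩⟩, L, hL.lipschitzOnWith⟩
  · exact (hScomp.image e.continuous).image (by fun_prop)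
  · rintro _ ⟨y, hy, rfl⟩
    exact (hsol y (hsub hy)).1
  · rintro _ ⟨y, hy, rfl⟩
    exact (hsol y (hsub hy)).2
  · rw [dimH_image_homothety x₀ hρ.ne', ContinuousLinearEquiv.dimH_image, hSdim]
  · exact (contDiff_one_iff_fderiv.2 ⟨hud, hL.continuous⟩).contDiffOn
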